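/- Conventions. A simplicial complex $X$ is a finite, pure, downward closed family of finite sets (including $\emptyset$); $X(i)$ is the set of its faces with $i+1$ elements and $d=\dim X$. Weights are $w_X(\sigma)=\frac{|\{\tau\in X(d):\sigma\subseteq\tau\}|}{\binom{d+1}{|\sigma|}|X(d)|}$, and $\|S\|=\sum_{\sigma\in S}w_X(\sigma)$. The link of $\sigma\in X$ is $X_\sigma=\{\tau\setminus\sigma:\sigma\subseteq\tau\in X\}$. For a group $G$: $C^0(X;G)$ is the set of functions $X(0)\to G$; $C^1(X;G)$ is the set of functions $f$ on oriented edges with $f(v,u)=f(u,v)^{-1}$; $d_0f(u,v)=f(u)f(v)^{-1}$ and $d_1f(u,v,w)=f(u,v)f(v,w)f(w,u)$; $B^0$ is the set of constant functions and $B^1=d_0(C^0)$. The norm $\|f\|$ of a cochain is the weight of the set of faces where $f\neq1$, $\mathrm{dist}(f,B^i)=\min_{g\in B^i}\|fg^{-1}\|$, and $h_i(X;G)=\min_{f\in C^i\setminus B^i}\|d_if\|/\mathrm{dist}(f,B^i)$ ($i=0,1$). $X$ is a $\gamma$-coboundary expander with coefficients in $G$ if $h_0(X_\sigma;G)\ge\gamma$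 and $h_1(X_\sigma;G)\ge\gamma$ for every face $\sigma\in X$ (including $\emptyset$) with $\dim\sigma<\dim X-2$. $S_l$ is the symmetric group on $[l]$. An assignment $a$ to the $k$-faces of $X$ is a family of functions $a^s:s\to\{0,1\}$, $s\in X(k)$; it is agreeing if $a^s=f|_s$ for all $s$, for one function $f:X(0)\to\{0,1\}$. $\mathrm{dist}(a,\mathcal A)$ is the least weight of a set of faces outside of which $a$ coincides with some agreeing assignment. An $l$-assignment is a family $F^s_i:s\to\{0,1\}$, $s\in X(k)$, $i\in[l]$; it is agreeing if there are $f_1,\dots,f_l:X(0)\to\{0,1\}$ and permutations $\pi_s\in S_l$ with $F^s_{\pi_s(i)}=f_i|_s$ for all $s,i$. $\mathrm{dist}(F,\mathcal A)$ is the minimum over agreeing $l$-assignments $H$ of $\sum_{s\in X(k)}w_X(s)\,|\{i:F^s_i\ne H^s_i\}|/l$. $F$ is $r$-locally-differing if, for all $s$ and $i\neq j$, $F^s_i$ and $F^s_j$ differ on at least $r$ vertices of $s$. An agreement test $T$ on the $k$-faces is a distribution $\mathcal D$ over pairs $\{s,t\}$ of $k$-faces; it samples $\{s,t\}\sim\mathcal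 D$ and rejects $a$ iff $a^s|_{s\cap t}\ne a^t|_{s\cap t}$. It has soundness $\alpha$ if $\Pr[T\text{ rejects }a]\ge\alpha\,\mathrm{dist}(a,\mathcal A)$ for every assignment $a$. Its test graph has vertex set $X(k)$, the pairs of positive probability as edges, and these probabilities as edge weights $w_T$. The algorithm. Let $X'$ be a complex with vertex set $X(k)$. An edge $\{s,t\}$ is adequately covered if there is $\pi\in S_l$ with $F^s_i(v)=F^t_{\pi(i)}(v)$ for all $v\in s\cap t$ and all $i$. Let $\pi_{s,t}$ be such a permutation (an arbitrary one, with $\pi_{t,s}=\pi_{s,t}^{-1}$) if there is one, and the identity otherwise, and put $c(s,t)=\pi_{s,t}^{-1}$. The list agreement test, given query access to the functions $F^s_i$, does one of the following, each with probability $1/2$: (a) sample a triangle $\{s,t,u\}\in X'(2)$ with probability $w_{X'}$, query the lists at $s,t,u$, and accept iff $c(s,t)\,c(t,u)\,c(u,s)=1$; (b) sample an edge $\{s,t\}\in X'(1)$ with probability $w_{X'}$, query the lists at $s,t$, and accept iff the edge is adequately covered. Theorem (Main Theorem, Generalized). Let $X$ be a simplicial complex and let $T$ be an agreement test on the $k$-faces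 of $X$ with soundness $\alpha>0$. Suppose that the test graph of $T$ is the $1$-skeleton of a $\gamma$-coboundary expander $X'$ with coefficients in $S_l$, where $\gamma>0$ and $\dim X'\ge2$, and that $w_T(\{s,t\})=w_{X'}(\{s,t\})$ for every edge. Then, for every choice of the matching permutations $\pi_{s,t}$, the list agreement test over $X'$ is a test for $l$-agreement over $X(k)$: 1. it makes at most $3l$ queries; 2. every $l$-assignment $F$ is rejected with probability at least $\frac{\alpha\gamma}{2(\gamma+1)}\,\mathrm{dist}(F,\mathcal A)$; 3. every agreeing $l$-assignment $F$ such that for every edge $\{s,t\}$ of the test graph and all $i\ne j$ the functions $F^s_i$ and $F^s_j$ differ on $s\cap t$ is accepted with probability $1$. In particular, if $|s\cap t|\ge k+2-r$ for every edge $\{s,t\}$ of the test graph, then every agreeing $r$-locally-differing $l$-assignment is accepted with probability $1$ (so $r=2$ suffices when the two faces in each tested pair share all but one of their vertices). -/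

import Mathlib

open scoped ENNReal

/-! ### Finite simplicial complexes, weights, links -/

/-- A finite simplicial complex on vertices taken from `V`.  The empty face belongs to the complex
(Mathlib's abstract simplicial complexes have neither finiteness nor the empty face). -/
structure FinComplex (V : Type*) where
  faces : Finset (Finset V)
  empty_mem : ∅ ∈ faces
  down_closed : ∀ σ ∈ faces, ∀ τ ⊆ σ, τ ∈ faces

namespace FinComplex

variable {V : Type*}

/-- The largest cardinality of a face, i.e. `dim X + 1`. -/
def rank (X : FinComplex V) : ℕ := X.faces.sup Finset.card

/-- The dimension of the complex (`-1` for the complex whose only face is `∅`). -/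
def dim (X : FinComplex V) : ℤ := (X.rank : ℤ) - 1

/-- `X(i)`: the faces of dimension `i`, i.e. of cardinality `i + 1`. -/
def facesOfDim (X : FinComplex V) (i : ℕ) : Finset (Finset V) :=
  X.faces.filter (fun σ => σ.card = i + 1)

/-- `X(d)` for `d = dim X`. -/
def topFaces (X : FinComplex V) : Finset (Finset V) :=
  X.faces.filter (fun σ => σ.card = X.rank)

/-- All inclusion-maximal faces have the same dimension. -/
def IsPure (X : FinComplex V) : Prop :=
  ∀ σ ∈ X.faces, (∀ τ ∈ X.faces, σ ⊆ τ → τ = σ) → σ.card = X.rank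

open scoped Classical in
/-- `w(σ) = #{τ ∈ X(d) : σ ⊆ τ} / (binom (d+1) |σ| * #X(d))`. -/
noncomputable def weight (X : FinComplex V) (σ : Finset V) : ℝ :=
  ((X.topFaces.filter (fun τ => σ ⊆ τ)).card : ℝ) /
    ((X.rank.choose σ.card : ℝ) * (X.topFaces.card : ℝ))

/-- `‖S‖ = ∑_{σ ∈ S} w(σ)`. -/
noncomputable def norm (X : FinComplex V) (S : Finset (Finset V)) : ℝ :=
  ∑ σ ∈ S, X.weight σ

/-- The link of a face `σ`: the faces `τ \ σ` for `σ ⊆ τ ∈ X`. -/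
def link [DecidableEq V] (X : FinComplex V) (σ : Finset V) (hσ : σ ∈ X.faces) : FinComplex V where
  faces := (X.faces.filter (fun τ => σ ⊆ τ)).image (fun τ => τ \ σ)
  empty_mem := by
    refine Finset.mem_image.2 ⟨σ, Finset.mem_filter.2 ⟨hσ, subset_rfl⟩, ?_⟩
    simp
  down_closed := by
    intro ρ hρ η hη
    obtain ⟨τ, hτ, rfl⟩ := Finset.mem_image.1 hρ
    obtain ⟨hτ, hστ⟩ := Finset.mem_filter.1 hτ
    refine Finset.mem_image.2 ⟨η ∪ σ, Finset.mem_filter.2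
      ⟨X.down_closed τ hτ _ ?_, Finset.subset_union_right⟩, ?_⟩
    · exact Finset.union_subset (hη.trans Finset.sdiff_subset) hστ
    · ext x
      have := @hη x
      simp only [Finset.mem_sdiff, Finset.mem_union] at this ⊢
      tauto

/-! ### Cochains with coefficients in a group -/

/-- The vertices of `X`. -/
abbrev Vertex (X : FinComplex V) : Type _ := {v : V // {v} ∈ X.faces}

/-- The edges of `X` with an orientation. -/
abbrev OrEdge [DecidableEq V] (X : FinComplex V) : Type _ :=
  {e : V × V // e.1 ≠ e.2 ∧ {e.1, e.2} ∈ X.faces}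

/-- The triangles of `X` with an ordering of their vertices. -/
abbrev OrTriangle [DecidableEq V] (X : FinComplex V) : Type _ :=
  {t : V × V × V // (t.1 ≠ t.2.1 ∧ t.2.1 ≠ t.2.2 ∧ t.2.2 ≠ t.1) ∧
    {t.1, t.2.1, t.2.2} ∈ X.faces}

section
variable [DecidableEq V] {X : FinComplex V}

/-- The edge `(u, v)` read as `(v, u)`. -/
def OrEdge.reverse (e : X.OrEdge) : X.OrEdge :=
  ⟨(e.1.2, e.1.1), e.2.1.symm, by
    have := e.2.2
    rwa [Finset.pair_comm] at this⟩

/-- The vertex `u` of the edge `(u, v)`. -/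
def OrEdge.fst (e : X.OrEdge) : X.Vertex :=
  ⟨e.1.1, X.down_closed _ e.2.2 _ (by simp)⟩

/-- The vertex `v` of the edge `(u, v)`. -/
def OrEdge.snd (e : X.OrEdge) : X.Vertex :=
  ⟨e.1.2, X.down_closed _ e.2.2 _ (by simp)⟩

/-- The edge `(u, v)` of the triangle `(u, v, w)`. -/
def OrTriangle.edge₁ (t : X.OrTriangle) : X.OrEdge :=
  ⟨(t.1.1, t.1.2.1), t.2.1.1, X.down_closed _ t.2.2 _ (by
    intro x; simp only [Finset.mem_insert, Finset.mem_singleton]; tauto)⟩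

/-- The edge `(v, w)` of the triangle `(u, v, w)`. -/
def OrTriangle.edge₂ (t : X.OrTriangle) : X.OrEdge :=
  ⟨(t.1.2.1, t.1.2.2), t.2.1.2.1, X.down_closed _ t.2.2 _ (by
    intro x; simp only [Finset.mem_insert, Finset.mem_singleton]; tauto)⟩

/-- The edge `(w, u)` of the triangle `(u, v, w)`. -/
def OrTriangle.edge₃ (t : X.OrTriangle) : X.OrEdge :=
  ⟨(t.1.2.2, t.1.1), t.2.1.2.2, X.down_closed _ t.2.2 _ (by
    intro x; simp only [Finset.mem_insert, Finset.mem_singleton]; tauto)⟩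

end

variable [DecidableEq V] (X : FinComplex V) (G : Type*) [Group G]

/-- `C⁰(X; G)`. -/
abbrev Cochain0 : Type _ := X.Vertex → G

/-- `C¹(X; G)`: functions on oriented edges with `f(v, u) = f(u, v)⁻¹`. -/
abbrev Cochain1 : Type _ := {f : X.OrEdge → G // ∀ e, f e.reverse = (f e)⁻¹}

variable {X G}

/-- `d₀ f (u, v) = f(u) f(v)⁻¹`. -/
def d0 (f : X.Cochain0 G) : X.Cochain1 G :=
  ⟨fun e => f e.fst * (f e.snd)⁻¹, fun e => by
    simp [OrEdge.reverse, OrEdge.fst, OrEdge.snd]⟩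

/-- `d₁ f (u, v, w) = f(u, v) f(v, w) f(w, u)`. -/
def d1 (f : X.Cochain1 G) : X.OrTriangle → G :=
  fun t => f.1 t.edge₁ * f.1 t.edge₂ * f.1 t.edge₃

variable (X G)

/-- `B⁰(X; G)`: the image of `d₋₁`, i.e. the constant functions. -/
def coboundaries0 : Set (X.Cochain0 G) := Set.range (fun (g : G) (_ : X.Vertex) => g)

/-- `B¹(X; G)`: the image of `d₀`. -/
def coboundaries1 : Set (X.Cochain1 G) := Set.range d0

variable {X G}

open scoped Classical in
/-- The norm of a function on vertices: the weight of `{v : f v ≠ 1}`. -/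
noncomputable def norm0 (f : X.Vertex → G) : ℝ :=
  X.norm ((X.facesOfDim 0).filter (fun σ => ∃ v : X.Vertex, σ = {v.1} ∧ f v ≠ 1))

open scoped Classical in
/-- The norm of a function on edges: the weight of the edges where it is not `1`. -/
noncomputable def norm1 (f : X.OrEdge → G) : ℝ :=
  X.norm ((X.facesOfDim 1).filter (fun σ => ∃ e : X.OrEdge, σ = {e.1.1, e.1.2} ∧ f e ≠ 1))

open scoped Classical in
/-- The norm of a function on triangles: the weight of the triangles where it is not `1`. -/
noncomputable def norm2 (f : X.OrTriangle → G) : ℝ :=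
  X.norm ((X.facesOfDim 2).filter
    (fun σ => ∃ t : X.OrTriangle, σ = {t.1.1, t.1.2.1, t.1.2.2} ∧ f t ≠ 1))

/-- `dist(f, B⁰)`. -/
noncomputable def distB0 (f : X.Cochain0 G) : ℝ :=
  ⨅ g : X.coboundaries0 G, norm0 (fun v => f v * (g.1 v)⁻¹)

/-- `dist(f, B¹)`. -/
noncomputable def distB1 (f : X.Cochain1 G) : ℝ :=
  ⨅ g : X.coboundaries1 G, norm1 (fun e => f.1 e * (g.1.1 e)⁻¹)

variable (X G)

/-- The Cheeger constant `h₀(X; G)`, the least ratio `‖d₀ f‖ / dist(f, B⁰)` over cochains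
`f ∉ B⁰` (`∞` if there are none). -/
noncomputable def cheeger0 : ℝ≥0∞ :=
  ⨅ (f : X.Cochain0 G) (_ : f ∉ X.coboundaries0 G), ENNReal.ofReal (norm1 (d0 f).1 / distB0 f)

/-- The Cheeger constant `h₁(X; G)`, the least ratio `‖d₁ f‖ / dist(f, B¹)` over cochains
`f ∉ B¹` (`∞` if there are none). -/
noncomputable def cheeger1 : ℝ≥0∞ :=
  ⨅ (f : X.Cochain1 G) (_ : f ∉ X.coboundaries1 G), ENNReal.ofReal (norm2 (d1 f) / distB1 f)

/-- `X` is an `ε`-coboundary expander with coefficients in `G`: `h₀, h₁ ≥ ε` in the link of every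
face of dimension less than `dim X - 2` (including the face `∅`, of dimension `-1`). -/
def IsCoboundaryExpander (ε : ℝ) : Prop :=
  ∀ (σ : Finset V) (hσ : σ ∈ X.faces), (σ.card : ℤ) - 1 < X.dim - 2 →
    ENNReal.ofReal ε ≤ (X.link σ hσ).cheeger0 G ∧ ENNReal.ofReal ε ≤ (X.link σ hσ).cheeger1 G

end FinComplex

/-! ### Sampling faces -/

namespace FinComplex

variable {V : Type*}

theorem topFaces_nonempty (X : FinComplex V) : X.topFaces.Nonempty := by
  obtain ⟨σ, hσ, h⟩ := Finset.exists_mem_eq_sup X.faces ⟨∅, X.empty_mem⟩ Finset.card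
  exact ⟨σ, Finset.mem_filter.2 ⟨hσ, h.symm⟩⟩

/-- Sample a face with `n` vertices according to its weight, and order its vertices at random:
pick a uniform top-dimensional face, then `n` distinct vertices of it uniformly. -/
noncomputable def sampleFace (X : FinComplex V) (n : ℕ) (hn : n ≤ X.rank) : PMF (Fin n → V) :=
  (PMF.uniformOfFinset X.topFaces.attach X.topFaces_nonempty.attach).bind fun τ =>
    haveI : Nonempty (Fin n ↪ {v // v ∈ τ.1}) :=
      Function.Embedding.nonempty_of_card_le (by
        simpa using hn.trans_eq (Finset.mem_filter.1 τ.2).2.symm)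
    (PMF.uniformOfFintype (Fin n ↪ {v // v ∈ τ.1})).map fun p i => (p i).1

/-! ### Assignments and `l`-assignments -/

/-- The `k`-dimensional faces of `X`. -/
abbrev Face (X : FinComplex V) (k : ℕ) : Type _ := {s : Finset V // s ∈ X.facesOfDim k}

variable {X : FinComplex V} {k l : ℕ}

/-- Functions `s → {0, 1}`. -/
abbrev Local (s : X.Face k) : Type _ := {x : V // x ∈ s.1} → Bool

/-- A point of a face, as a vertex of the complex. -/
def Face.vertex (s : X.Face k) (x : {x : V // x ∈ s.1}) : X.Vertex :=
  ⟨x.1, X.down_closed s.1 (Finset.mem_filter.1 s.2).1 _ (by simp)⟩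

variable (X k l)

/-- Assignments to the `k`-faces of `X`. -/
abbrev Assignment : Type _ := (s : X.Face k) → Local s

/-- `k`-dimensional `l`-assignments. -/
abbrev LAssignment : Type _ := (s : X.Face k) → Fin l → Local s

variable {X k l}

/-- `a` consists of the restrictions of the global function `f`. -/
def Assignment.AgreesWith (a : X.Assignment k) (f : X.Vertex → Bool) : Prop :=
  ∀ (s : X.Face k) (x : {x : V // x ∈ s.1}), f (s.vertex x) = a s x

/-- The agreeing assignments. -/
def Assignment.IsAgreeing (a : X.Assignment k) : Prop :=
  ∃ f : X.Vertex → Bool, a.AgreesWith f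

open scoped Classical in
/-- The weight of the faces on which two assignments differ. -/
noncomputable def Assignment.dist (a b : X.Assignment k) : ℝ :=
  ∑ s : X.Face k, if a s ≠ b s then X.weight s.1 else 0

/-- The distance from the set of agreeing assignments. -/
noncomputable def Assignment.distAgreeing (a : X.Assignment k) : ℝ :=
  ⨅ b : {b : X.Assignment k // b.IsAgreeing}, a.dist b.1

/-- There are `l` global functions and, for each face `s`, a permutation `π s` such that the local
functions numbered `π s i` are the restrictions of the `i`-th global function. -/
def LAssignment.IsAgreeing (F : X.LAssignment k l) : Prop :=
  ∃ (f : Fin l → X.Vertex → Bool) (π : X.Face k → Equiv.Perm (Fin l)),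
    ∀ i, Assignment.AgreesWith (fun s => F s (π s i)) (f i)

open scoped Classical in
/-- The weighted fraction of local functions on which two `l`-assignments differ. -/
noncomputable def LAssignment.dist (F H : X.LAssignment k l) : ℝ :=
  ∑ s : X.Face k, X.weight s.1 *
    (((Finset.univ.filter (fun i : Fin l => F s i ≠ H s i)).card : ℝ) / (l : ℝ))

/-- The distance from the set of agreeing `l`-assignments. -/
noncomputable def LAssignment.distAgreeing (F : X.LAssignment k l) : ℝ :=
  ⨅ H : {H : X.LAssignment k l // H.IsAgreeing}, F.dist H.1

open scoped Classical in
/-- `F` is `r`-locally-differing: on every face, any two entries of the list differ in at least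
`r` vertices. -/
def LAssignment.LocallyDiffering (r : ℕ) (F : X.LAssignment k l) : Prop :=
  ∀ (s : X.Face k) (i j : Fin l), i ≠ j →
    r ≤ (Finset.univ.filter (fun x => F s i x ≠ F s j x)).card

/-! ### Agreement tests and their test graphs -/

variable (X k)

/-- An agreement test on the `k`-faces: a distribution over pairs `{s, t}` of `k`-faces.  The test
samples such a pair and checks whether the two local functions coincide on `s ∩ t`. -/
abbrev AgreementTest : Type _ := PMF (Sym2 (X.Face k))

variable {X k}

/-- The probability that the agreement test rejects the assignment `a`. -/
noncomputable def AgreementTest.rejectProb (T : X.AgreementTest k) (a : X.Assignment k) : ℝ :=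
  (T.toOuterMeasure {e | ∃ s t : X.Face k, e = s(s, t) ∧
    ∃ (x : V) (hs : x ∈ s.1) (ht : x ∈ t.1), a s ⟨x, hs⟩ ≠ a t ⟨x, ht⟩}).toReal

/-- The agreement test has soundness `α`: every assignment is rejected with probability at least
`α` times its distance from the agreeing assignments.  (Agreeing assignments are never rejected.) -/
def AgreementTest.HasSoundness (T : X.AgreementTest k) (α : ℝ) : Prop :=
  ∀ a : X.Assignment k, α * a.distAgreeing ≤ T.rejectProb a

/-- The edges of the test graph: the pairs of positive probability. -/
def AgreementTest.edges (T : X.AgreementTest k) : Set (Sym2 (X.Face k)) := {e | 0 < T e}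

/-- The weights of the test graph. -/
noncomputable def AgreementTest.edgeWeight (T : X.AgreementTest k) (e : Sym2 (X.Face k)) : ℝ :=
  (T e).toReal

/-- The test graph of `T` (with vertex set `X(k)`) is the `1`-skeleton of `X'`, and its edges have
the weights that they have in `X'`. -/
def AgreementTest.TestGraphIsOneSkeleton [DecidableEq V] (T : X.AgreementTest k)
    (X' : FinComplex (X.Face k)) : Prop :=
  (∀ s : X.Face k, {s} ∈ X'.faces) ∧
  (∀ s t : X.Face k, s(s, t) ∈ T.edges ↔ s ≠ t ∧ {s, t} ∈ X'.faces) ∧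
  (∀ s t : X.Face k, s(s, t) ∈ T.edges → T.edgeWeight s(s, t) = X'.weight {s, t})

/-- On each edge `{s, t}` of the test graph, the entries of the list at `s` can be told apart on
`s ∩ t`. -/
def AgreementTest.Separates (T : X.AgreementTest k) (F : X.LAssignment k l) : Prop :=
  ∀ s t : X.Face k, s(s, t) ∈ T.edges → ∀ i j : Fin l, i ≠ j →
    ∃ (x : V) (hs : x ∈ s.1) (_ : x ∈ t.1), F s i ⟨x, hs⟩ ≠ F s j ⟨x, hs⟩

/-! ### Algorithms with query access to an `l`-assignment -/

variable (X k l)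

/-- A deterministic adaptive algorithm: it either halts and accepts (`true`) or rejects (`false`),
or queries one local function `F s i` and continues depending on the answer. -/
inductive QueryAlg : Type _
  | halt (accept : Bool) : QueryAlg
  | query (s : X.Face k) (i : Fin l) (next : Local s → QueryAlg) : QueryAlg

variable {X k l}

/-- The verdict on the `l`-assignment `F`. -/
def QueryAlg.run (F : X.LAssignment k l) : X.QueryAlg k l → Bool
  | .halt b => b
  | .query s i next => QueryAlg.run F (next (F s i))

/-- The number of queries made to the `l`-assignment `F`. -/
def QueryAlg.queries (F : X.LAssignment k l) : X.QueryAlg k l → ℕ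
  | .halt _ => 0
  | .query s i next => QueryAlg.queries F (next (F s i)) + 1

/-- Query the first `n` local functions of the list at `s`, and continue with the answers. -/
def QueryAlg.queryFirst (s : X.Face k) : (n : ℕ) → n ≤ l →
    ((Fin n → Local s) → X.QueryAlg k l) → X.QueryAlg k l
  | 0, _, next => next Fin.elim0
  | n + 1, h, next => QueryAlg.queryFirst s n (Nat.le_of_succ_le h) fun g =>
      .query s ⟨n, h⟩ fun a => next (Fin.snoc (α := fun _ => Local s) g a)

/-- Query the whole list at `s`, and continue with the answers. -/
def QueryAlg.queryList (s : X.Face k) (next : (Fin l → Local s) → X.QueryAlg k l) :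
    X.QueryAlg k l :=
  QueryAlg.queryFirst s l le_rfl next

/-- The probability that a probabilistic algorithm (a random choice of a deterministic one)
accepts. -/
noncomputable def acceptProb (A : PMF (X.QueryAlg k l)) (F : X.LAssignment k l) : ℝ :=
  ((A.map (QueryAlg.run F)) true).toReal

/-- The probability that a probabilistic algorithm rejects. -/
noncomputable def rejectProb (A : PMF (X.QueryAlg k l)) (F : X.LAssignment k l) : ℝ :=
  ((A.map (QueryAlg.run F)) false).toReal

/-! ### The test for list agreement -/

/-- The permutation `π` matches the list `f` at `s` with the list `g` at `t`:
`f i (x) = g (π i) (x)` for all `x ∈ s ∩ t` and all `i`. -/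
def Matches (s t : X.Face k) (f : Fin l → Local s) (g : Fin l → Local t)
    (π : Equiv.Perm (Fin l)) : Prop :=
  ∀ (x : V) (hs : x ∈ s.1) (ht : x ∈ t.1) (i : Fin l), f i ⟨x, hs⟩ = g (π i) ⟨x, ht⟩

variable (X k l)

/-- A way to carry out the query for the cover of an edge `{s, t}`: return a permutation that
matches the lists, if there is one, and the identity otherwise.  Which matching permutation is
taken is arbitrary, but the edges `(s, t)` and `(t, s)` get the same matching of the lists. -/
structure CoverRule where
  perm : (s t : X.Face k) → (Fin l → Local s) → (Fin l → Local t) → Equiv.Perm (Fin l)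
  matching : ∀ s t f g, (∃ π, Matches s t f g π) → Matches s t f g (perm s t f g)
  default : ∀ s t f g, (¬ ∃ π, Matches s t f g π) → perm s t f g = 1
  symm : ∀ s t f g, s ≠ t → perm t s g f = (perm s t f g)⁻¹

variable {X k l}

theorem Matches.inv {s t : X.Face k} {f : Fin l → Local s} {g : Fin l → Local t}
    {π : Equiv.Perm (Fin l)} (h : Matches s t f g π) : Matches t s g f π⁻¹ := by
  intro x ht hs i
  have := h x hs ht (π⁻¹ i)
  rw [this]
  simp

theorem matches_inv_iff {s t : X.Face k} {f : Fin l → Local s} {g : Fin l → Local t} :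
    (∃ π, Matches t s g f π) ↔ ∃ π, Matches s t f g π :=
  ⟨fun ⟨_, h⟩ => ⟨_, h.inv⟩, fun ⟨_, h⟩ => ⟨_, h.inv⟩⟩

open scoped Classical in
/-- Cover rules exist. -/
instance : Nonempty (X.CoverRule k l) := by
  let c : (s t : X.Face k) → (Fin l → Local s) → (Fin l → Local t) → Equiv.Perm (Fin l) :=
    fun s t f g => if h : ∃ π, Matches s t f g π then h.choose else 1
  have hc : ∀ s t f g, (∃ π, Matches s t f g π) → Matches s t f g (c s t f g) := by
    intro s t f g h
    simp only [c, dif_pos h]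
    exact h.choose_spec
  have hd : ∀ s t f g, (¬ ∃ π, Matches s t f g π) → c s t f g = 1 := by
    intro s t f g h
    simp only [c, dif_neg h]
  refine ⟨⟨fun s t f g => if WellOrderingRel s t then c s t f g else (c t s g f)⁻¹, ?_, ?_, ?_⟩⟩
  · intro s t f g h
    split_ifs with hst
    · exact hc s t f g h
    · exact (hc t s g f (matches_inv_iff.2 h)).inv
  · intro s t f g h
    split_ifs with hst
    · exact hd s t f g h
    · rw [hd t s g f (fun h' => h (matches_inv_iff.1 h')), inv_one]
  · intro s t f g hne
    rcases trichotomous_of WellOrderingRel s t with h | h | h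
    · simp [h, asymm_of WellOrderingRel h]
    · exact absurd h hne
    · simp [h, asymm_of WellOrderingRel h]

/-- Query the lists at the three vertices of a triangle of the test complex and check that the
`1`-cochain `c` of the resulting near cover has `c(s₀, s₁) c(s₁, s₂) c(s₂, s₀) = 1`.  The near cover
joins the point `i` over `s` to the point `π i` over `t`, where `π` is the matching permutation;
since a cochain `c` joins the point `c(s, t) j` over `s` to the point `j` over `t`, we have
`c(s, t) = π⁻¹`. -/
noncomputable def triangleTest (ρ : X.CoverRule k l) (s : Fin 3 → X.Face k) : X.QueryAlg k l :=
  .queryList (s 0) fun f₀ => .queryList (s 1) fun f₁ => .queryList (s 2) fun f₂ =>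
    .halt (decide ((ρ.perm (s 0) (s 1) f₀ f₁)⁻¹ * (ρ.perm (s 1) (s 2) f₁ f₂)⁻¹ *
      (ρ.perm (s 2) (s 0) f₂ f₀)⁻¹ = 1))

open scoped Classical in
/-- Query the lists at the two ends of an edge and check that the edge is adequately covered. -/
noncomputable def edgeTest (s : Fin 2 → X.Face k) : X.QueryAlg k l :=
  .queryList (s 0) fun f₀ => .queryList (s 1) fun f₁ =>
    .halt (decide (∃ π, Matches (s 0) (s 1) f₀ f₁ π))

/-- The test for list agreement over a complex `X'` on the `k`-faces of `X`: with probability `1/2`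
run the coboundary test (sample a triangle of `X'` and check the cochain of the near cover on it),
and otherwise sample an edge of `X'` and check that it is adequately covered. -/
noncomputable def listAgreementTest (X' : FinComplex (X.Face k)) (hdim : 2 ≤ X'.dim)
    (ρ : X.CoverRule k l) : PMF (X.QueryAlg k l) :=
  (PMF.uniformOfFintype Bool).bind fun b =>
    if b then (X'.sampleFace 3 (by unfold dim at hdim; omega)).map (triangleTest ρ)
    else (X'.sampleFace 2 (by unfold dim at hdim; omega)).map edgeTest

end FinComplex

/-! The inverse matching permutations form a 1-cochain `c` on `X'` with values in S_l, equal to the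
identity on edges that are not adequately covered. Let S be the set of those edges. The triangle
half of the test rejects with probability at least ‖d₁c‖ and the edge half with probability at least
‖S‖ (`norm_le_sampleFace`), so the test rejects with probability at least (‖d₁c‖ + ‖S‖)/2.

Soundness: expansion gives a 0-cochain g with γN ≤ ‖d₁c‖, where N is the weight of the edges on
which c ≠ d₀g (`IsCoboundaryExpander.exists_norm1_le`). Renumber the list at each s by g(s), which
splits F into l ordinary assignments s ↦ F^s_{g(s)i}. On an adequately covered edge with c = d₀g the
matching permutation is g(t)g(s)⁻¹, so each of these assignments is consistent there. Hence `T`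
rejects each with probability at most N + ‖S‖ (`AgreementTest.rejectProb_le_norm`), and each is
within (N + ‖S‖)/α of an agreeing one. The distance of F is at most the average of these l distances
(`LAssignment.distAgreeing_le_of_renumbering`), which gives the bound.

Completeness: if F agrees through permutations π_s, then π_tπ_s⁻¹ matches the lists at s and t.
Separation makes this the only matching permutation, so c is the coboundary of π and every triangle
product telescopes to 1. -/

namespace FinComplex

/-! ### Weights and links -/

section Weights
variable {W : Type*} (Y : FinComplex W)

theorem weight_nonneg (σ : Finset W) : 0 ≤ Y.weight σ := by
  unfold weight; positivity

theorem norm_nonneg (S : Finset (Finset W)) : 0 ≤ Y.norm S :=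
  Finset.sum_nonneg fun σ _ => Y.weight_nonneg σ

theorem norm_union_le [DecidableEq (Finset W)] (S S' : Finset (Finset W)) :
    Y.norm (S ∪ S') ≤ Y.norm S + Y.norm S' := by
  have h := Finset.sum_union_inter (s₁ := S) (s₂ := S') (f := Y.weight)
  have h' := Y.norm_nonneg (S ∩ S')
  unfold norm at h' ⊢
  linarith

theorem link_empty [DecidableEq W] : Y.link ∅ Y.empty_mem = Y := by
  cases Y
  simp [link]

variable {Y}

open scoped Classical in
theorem exists_norm1_eq [DecidableEq W] {G : Type*} [Group G] (f : Y.OrEdge → G) :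
    ∃ S : Finset (Finset W), norm1 f = Y.norm S ∧
      ∀ σ, σ ∈ S ↔ σ ∈ Y.facesOfDim 1 ∧ ∃ e : Y.OrEdge, σ = {e.1.1, e.1.2} ∧ f e ≠ 1 :=
  ⟨_, rfl, fun _ => Finset.mem_filter⟩

open scoped Classical in
theorem exists_norm2_eq [DecidableEq W] {G : Type*} [Group G] (f : Y.OrTriangle → G) :
    ∃ S : Finset (Finset W), norm2 f = Y.norm S ∧
      ∀ σ, σ ∈ S ↔ σ ∈ Y.facesOfDim 2 ∧
        ∃ t : Y.OrTriangle, σ = {t.1.1, t.1.2.1, t.1.2.2} ∧ f t ≠ 1 :=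
  ⟨_, rfl, fun _ => Finset.mem_filter⟩

/-- This is h₁ ≥ γ for the link of ∅, without quotients. Finiteness of `G` and of the complex makes
the distance to B¹ a minimum, attained at some d₀g. Cochains in B¹, which the Cheeger constant
leaves out, are their own nearest coboundary. -/
theorem IsCoboundaryExpander.exists_norm1_le [DecidableEq W] {G : Type*} [Group G] [Finite G]
    {γ : ℝ} (h : Y.IsCoboundaryExpander G γ) (hdim : 2 ≤ Y.dim)
    (c : Y.Cochain1 G) :
    ∃ g : Y.Cochain0 G, γ * norm1 (fun e => c.1 e * ((d0 g).1 e)⁻¹) ≤ norm2 (d1 c) := by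
  have : Finite Y.Vertex := Set.Finite.to_subtype
    ((Y.faces.finite_toSet.preimage (Finset.singleton_injective.injOn)))
  have : Finite (Y.coboundaries1 G) := (Set.finite_range _).to_subtype
  have : Nonempty (Y.coboundaries1 G) := ⟨⟨d0 1, 1, rfl⟩⟩
  by_cases hc : c ∈ Y.coboundaries1 G
  · obtain ⟨g, rfl⟩ := hc
    refine ⟨g, ?_⟩
    have h0 : norm1 (fun e => (d0 g).1 e * ((d0 g).1 e)⁻¹) = 0 := by
      simp [norm1, norm]
    rw [h0, mul_zero]
    exact Y.norm_nonneg _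
  -- The face ∅ has dimension -1, and -1 < dim - 2 is exactly dim ≥ 2.
  · have h1 := (h ∅ Y.empty_mem (by simp; omega)).2
    rw [link_empty] at h1
    have h2 : ENNReal.ofReal γ ≤ ENNReal.ofReal (norm2 (d1 c) / distB1 c) :=
      h1.trans (iInf₂_le c hc)
    obtain ⟨⟨_, g, rfl⟩, hg⟩ := exists_eq_ciInf_of_finite
      (f := fun g : Y.coboundaries1 G => norm1 (fun e => c.1 e * (g.1.1 e)⁻¹))
    refine ⟨g, ?_⟩
    change _ = distB1 c at hg
    dsimp only at hg
    rw [hg]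
    have hn : 0 ≤ norm2 (d1 c) := Y.norm_nonneg _
    have hd : 0 ≤ distB1 c := hg ▸ Y.norm_nonneg _
    have h3 : γ ≤ norm2 (d1 c) / distB1 c :=
      (ENNReal.ofReal_le_ofReal_iff (div_nonneg hn hd)).1 h2
    rcases hd.eq_or_lt with h0 | h0
    · rw [← h0, mul_zero]; exact hn
    · exact (le_div_iff₀ h0).1 h3

end Weights

/-! ### The distribution of sampled faces -/

section Sampling
variable {W : Type*} (Y : FinComplex W)

theorem mem_support_sampleFace {n : ℕ} {hn : n ≤ Y.rank} {p : Fin n → W}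
    (hp : p ∈ (Y.sampleFace n hn).support) :
    Function.Injective p ∧ ∃ τ ∈ Y.faces, ∀ i, p i ∈ τ := by
  unfold sampleFace at hp
  obtain ⟨τ, -, hp⟩ := (PMF.mem_support_bind_iff _ _ _).1 hp
  obtain ⟨q, -, rfl⟩ := (PMF.mem_support_map_iff _ _ _).1 hp
  exact ⟨fun i j h => q.injective (Subtype.ext h), τ.1, (Finset.mem_filter.1 τ.2).1,
    fun i => (q i).2⟩

open scoped Classical in
-- Each top face containing all the points `p i` is drawn with probability 1/|X(d)|, and then yields
-- `p` as one of its `Y.rank.descFactorial n` equally likely embeddings.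
theorem le_sampleFace_apply {n : ℕ} (hn : n ≤ Y.rank) {p : Fin n → W}
    (hp : Function.Injective p) :
    ((Y.topFaces.filter fun τ => ∀ i, p i ∈ τ).card : ℝ≥0∞) *
      ((Y.topFaces.card : ℝ≥0∞)⁻¹ * (Y.rank.descFactorial n : ℝ≥0∞)⁻¹) ≤ Y.sampleFace n hn p := by
  unfold sampleFace
  rw [PMF.bind_apply, tsum_fintype, ← nsmul_eq_mul, ← Finset.sum_const,
    Finset.sum_filter, ← Finset.sum_coe_sort Y.topFaces]
  refine Finset.sum_le_sum fun τ _ => ?_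
  split_ifs with h
  · rw [PMF.uniformOfFinset_apply_of_mem _ (Finset.mem_attach _ _), Finset.card_attach]
    gcongr
    rw [PMF.map_apply]
    let q : Fin n ↪ {v // v ∈ τ.1} := ⟨fun i => ⟨p i, h i⟩, fun i j hij =>
      hp (congrArg Subtype.val hij)⟩
    have : Nonempty (Fin n ↪ {v // v ∈ τ.1}) := ⟨q⟩
    refine le_trans (le_of_eq ?_) (ENNReal.le_tsum q)
    rw [if_pos (by rfl), PMF.uniformOfFintype_apply, Fintype.card_embedding_eq, Fintype.card_fin,
      Fintype.card_coe, (Finset.mem_filter.1 τ.2).2]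
  · exact zero_le

open scoped Classical in
-- The factor n! counts the orderings of σ: the rest is the bound of `le_sampleFace_apply` for a
-- single ordering.
theorem ofReal_weight {n : ℕ} (hn : n ≤ Y.rank) {σ : Finset W} (hσ : σ.card = n) :
    ENNReal.ofReal (Y.weight σ) =
      (n.factorial : ℝ≥0∞) * (((Y.topFaces.filter fun τ => σ ⊆ τ).card : ℝ≥0∞) *
        ((Y.topFaces.card : ℝ≥0∞)⁻¹ * (Y.rank.descFactorial n : ℝ≥0∞)⁻¹)) := by
  have h1 : (0 : ℝ) < Y.rank.choose n := by exact_mod_cast Nat.choose_pos hn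
  have h2 : (0 : ℝ) < Y.topFaces.card := by exact_mod_cast Y.topFaces_nonempty.card_pos
  have h3 : (0 : ℝ) < n.factorial := by exact_mod_cast n.factorial_pos
  have h4 : (0 : ℝ) < Y.rank.descFactorial n := by
    rw [Nat.descFactorial_eq_factorial_mul_choose]; push_cast; positivity
  have key : Y.weight σ = (n.factorial : ℝ) * (((Y.topFaces.filter fun τ => σ ⊆ τ).card : ℝ) *
      ((Y.topFaces.card : ℝ)⁻¹ * (Y.rank.descFactorial n : ℝ)⁻¹)) := by
    unfold weight
    rw [hσ, Nat.descFactorial_eq_factorial_mul_choose]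
    push_cast
    field_simp
  rw [key, ENNReal.ofReal_mul h3.le, ENNReal.ofReal_mul (by positivity),
    ENNReal.ofReal_mul (by positivity), ENNReal.ofReal_inv_of_pos h2,
    ENNReal.ofReal_inv_of_pos h4]
  simp only [ENNReal.ofReal_natCast]

/-- An event that contains all orderings of the faces in `S` has probability at least `‖S‖`. -/
theorem norm_le_sampleFace {n : ℕ} (hn : n ≤ Y.rank) (S : Finset (Finset W))
    (hS : ∀ σ ∈ S, σ.card = n) (E : Set (Fin n → W))
    (hE : ∀ p : Fin n → W, Function.Injective p → ∀ σ ∈ S, (∀ x, x ∈ σ ↔ ∃ i, p i = x) → p ∈ E) :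
    Y.norm S ≤ ((Y.sampleFace n hn).toOuterMeasure E).toReal := by
  classical
  let ord (σ : Finset W) : Finset (Fin n → W) :=
    (Finset.univ : Finset (Fin n ≃ {x // x ∈ σ})).image fun e i => (e i).1
  have hord : ∀ σ, ∀ p ∈ ord σ, Function.Injective p ∧ ∀ x, x ∈ σ ↔ ∃ i, p i = x := by
    intro σ p hp
    obtain ⟨e, -, rfl⟩ := Finset.mem_image.1 hp
    refine ⟨fun i j h => e.injective (Subtype.ext h), fun x => ⟨fun hx => ⟨e.symm ⟨x, hx⟩, by simp⟩,
      ?_⟩⟩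
    rintro ⟨i, rfl⟩
    exact (e i).2
  have hcard : ∀ σ ∈ S, (ord σ).card = n.factorial := by
    intro σ hσ
    rw [Finset.card_image_of_injective, Finset.card_univ,
      Fintype.card_equiv (Fintype.equivOfCardEq (by simp [hS σ hσ])), Fintype.card_fin]
    intro e e' h
    ext i
    exact congrFun h i
  -- An ordering determines its face as its range, so the probabilities of the orderings add up over
  -- `S`.
  have hdisj : (S : Set (Finset W)).PairwiseDisjoint ord := by
    intro σ _ σ' _ hne
    refine Finset.disjoint_left.2 fun p hp hp' => hne ?_
    ext x
    rw [(hord σ p hp).2, (hord σ' p hp').2]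
  have hsub : (↑(S.biUnion ord) : Set (Fin n → W)) ⊆ E := by
    intro p hp
    obtain ⟨σ, hσ, hp⟩ := Finset.mem_biUnion.1 (Finset.mem_coe.1 hp)
    exact hE p (hord σ p hp).1 σ hσ (hord σ p hp).2
  have hle : ENNReal.ofReal (Y.norm S) ≤ (Y.sampleFace n hn).toOuterMeasure E := by
    refine le_trans ?_ (MeasureTheory.measure_mono hsub)
    rw [PMF.toOuterMeasure_apply_finset, Finset.sum_biUnion hdisj]
    unfold norm
    rw [ENNReal.ofReal_sum_of_nonneg fun σ _ => Y.weight_nonneg σ]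
    refine Finset.sum_le_sum fun σ hσ => ?_
    rw [Y.ofReal_weight hn (hS σ hσ), ← hcard σ hσ, ← nsmul_eq_mul, ← Finset.sum_const]
    refine Finset.sum_le_sum fun p hp => ?_
    refine le_trans (le_of_eq ?_) (Y.le_sampleFace_apply hn (hord σ p hp).1)
    congr 3
    refine Finset.filter_congr fun τ _ => ⟨fun h i => h (((hord σ p hp).2 _).2 ⟨i, rfl⟩),
      fun h x hx => ?_⟩
    obtain ⟨i, rfl⟩ := ((hord σ p hp).2 x).1 hx
    exact h i
  refine (ENNReal.ofReal_le_iff_le_toReal ?_).1 hle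
  refine ne_top_of_le_ne_top ENNReal.one_ne_top ?_
  exact (PMF.toOuterMeasure_mono _ (Set.subset_univ _)).trans_eq
    ((PMF.toOuterMeasure_apply_eq_one_iff _ _).2 (Set.subset_univ _))

end Sampling

/-! ### Query algorithms -/

section Queries
variable {V : Type*} {X : FinComplex V} {k l : ℕ} (F : X.LAssignment k l)

theorem snoc_castLE (s : X.Face k) {n : ℕ} (h : n + 1 ≤ l) :
    (Fin.snoc (α := fun _ => Local s) (fun i : Fin n => F s (i.castLE (Nat.le_of_succ_le h)))
      (F s ⟨n, h⟩)) = fun i => F s (i.castLE h) := by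
  funext i
  refine Fin.lastCases ?_ (fun j => ?_) i
  · rw [Fin.snoc_last]; rfl
  · rw [Fin.snoc_castSucc]; rfl

theorem QueryAlg.run_queryFirst (s : X.Face k) : ∀ (n : ℕ) (h : n ≤ l)
    (next : (Fin n → Local s) → X.QueryAlg k l),
    (QueryAlg.queryFirst s n h next).run F = (next fun i => F s (i.castLE h)).run F
  | 0, h, next => by
    rw [QueryAlg.queryFirst]
    congr 2
    funext i
    exact i.elim0
  | n + 1, h, next => by
    rw [QueryAlg.queryFirst, QueryAlg.run_queryFirst s n, QueryAlg.run, snoc_castLE]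

theorem QueryAlg.queries_queryFirst (s : X.Face k) : ∀ (n : ℕ) (h : n ≤ l)
    (next : (Fin n → Local s) → X.QueryAlg k l),
    (QueryAlg.queryFirst s n h next).queries F = (next fun i => F s (i.castLE h)).queries F + n
  | 0, h, next => by
    rw [QueryAlg.queryFirst, add_zero]
    congr 2
    funext i
    exact i.elim0
  | n + 1, h, next => by
    rw [QueryAlg.queryFirst, QueryAlg.queries_queryFirst s n, QueryAlg.queries, snoc_castLE]
    ring

@[simp]
theorem QueryAlg.run_queryList (s : X.Face k) (next : (Fin l → Local s) → X.QueryAlg k l) :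
    (QueryAlg.queryList s next).run F = (next (F s)).run F :=
  QueryAlg.run_queryFirst F s l le_rfl next

@[simp]
theorem QueryAlg.queries_queryList (s : X.Face k) (next : (Fin l → Local s) → X.QueryAlg k l) :
    (QueryAlg.queryList s next).queries F = (next (F s)).queries F + l :=
  QueryAlg.queries_queryFirst F s l le_rfl next

/-- The value of the `1`-cochain of the near cover on the pair `(s, t)`. -/
def CoverRule.value (ρ : X.CoverRule k l) (s t : X.Face k) : Equiv.Perm (Fin l) :=
  (ρ.perm s t (F s) (F t))⁻¹

theorem CoverRule.value_symm (ρ : X.CoverRule k l) {s t : X.Face k} (h : s ≠ t) :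
    ρ.value F t s = (ρ.value F s t)⁻¹ := by
  rw [CoverRule.value, CoverRule.value, ρ.symm s t _ _ h]

theorem run_triangleTest_iff (ρ : X.CoverRule k l) (s : Fin 3 → X.Face k) :
    (triangleTest ρ s).run F = true ↔
      ρ.value F (s 0) (s 1) * ρ.value F (s 1) (s 2) * ρ.value F (s 2) (s 0) = 1 := by
  simp [triangleTest, QueryAlg.run, CoverRule.value]

theorem run_edgeTest_iff (s : Fin 2 → X.Face k) :
    (edgeTest (l := l) s).run F = true ↔
      ∃ π, Matches (s 0) (s 1) (F (s 0)) (F (s 1)) π := by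
  simp [edgeTest, QueryAlg.run]

/-! ### Support, query count and verdict probabilities of the list agreement test -/

theorem mem_support_listAgreementTest {X' : FinComplex (X.Face k)} {hdim : 2 ≤ X'.dim}
    {ρ : X.CoverRule k l} {A : X.QueryAlg k l} (hA : A ∈ (listAgreementTest X' hdim ρ).support) :
    (∃ p : Fin 3 → X.Face k, (Function.Injective p ∧ ∃ τ ∈ X'.faces, ∀ i, p i ∈ τ) ∧
      A = triangleTest ρ p) ∨
    (∃ p : Fin 2 → X.Face k, (Function.Injective p ∧ ∃ τ ∈ X'.faces, ∀ i, p i ∈ τ) ∧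
      A = edgeTest p) := by
  obtain ⟨b, -, hA⟩ := (PMF.mem_support_bind_iff _ _ _).1 hA
  cases b
  · obtain ⟨p, hp, rfl⟩ := (PMF.mem_support_map_iff _ _ _).1 (by simpa using hA)
    exact Or.inr ⟨p, X'.mem_support_sampleFace ((PMF.mem_support_iff _ _).2 hp), rfl⟩
  · obtain ⟨p, hp, rfl⟩ := (PMF.mem_support_map_iff _ _ _).1 (by simpa using hA)
    exact Or.inl ⟨p, X'.mem_support_sampleFace ((PMF.mem_support_iff _ _).2 hp), rfl⟩

theorem queries_listAgreementTest_le {X' : FinComplex (X.Face k)} {hdim : 2 ≤ X'.dim}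
    {ρ : X.CoverRule k l} {A : X.QueryAlg k l} (hA : A ∈ (listAgreementTest X' hdim ρ).support) :
    A.queries F ≤ 3 * l := by
  rcases mem_support_listAgreementTest hA with ⟨p, -, rfl⟩ | ⟨p, -, rfl⟩
  · simp only [triangleTest, QueryAlg.queries_queryList, QueryAlg.queries]; omega
  · simp only [edgeTest, QueryAlg.queries_queryList, QueryAlg.queries]; omega

theorem pmf_map_apply_eq {α β : Type*} (f : α → β) (p : PMF α) (b : β) :
    p.map f b = p.toOuterMeasure {a | f a = b} := by
  rw [← PMF.toOuterMeasure_apply_singleton, PMF.toOuterMeasure_map_apply]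
  rfl

theorem rejectProb_listAgreementTest (X' : FinComplex (X.Face k)) (hdim : 2 ≤ X'.dim)
    (h3 : 3 ≤ X'.rank) (h2 : 2 ≤ X'.rank) (ρ : X.CoverRule k l) :
    rejectProb (listAgreementTest X' hdim ρ) F =
      (((X'.sampleFace 3 h3).toOuterMeasure {p | (triangleTest ρ p).run F = false}).toReal +
        ((X'.sampleFace 2 h2).toOuterMeasure {p | (edgeTest p).run F = false}).toReal) / 2 := by
  unfold rejectProb listAgreementTest
  rw [PMF.map_bind, PMF.bind_apply, tsum_bool]
  simp only [Bool.false_eq_true, if_false, if_true, PMF.map_comp, PMF.uniformOfFintype_apply,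
    Fintype.card_bool]
  rw [ENNReal.toReal_add (ENNReal.mul_ne_top (by simp) (PMF.apply_ne_top _ _))
    (ENNReal.mul_ne_top (by simp) (PMF.apply_ne_top _ _)), ENNReal.toReal_mul, ENNReal.toReal_mul,
    pmf_map_apply_eq, pmf_map_apply_eq]
  simp only [Function.comp_apply, Nat.cast_ofNat, ENNReal.toReal_inv, ENNReal.toReal_ofNat]
  ring

theorem acceptProb_eq_one {A : PMF (X.QueryAlg k l)} (h : ∀ a ∈ A.support, a.run F = true) :
    acceptProb A F = 1 := by
  unfold acceptProb
  have h1 : A.toOuterMeasure {a | a.run F = true} = 1 :=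
    (PMF.toOuterMeasure_apply_eq_one_iff _ _).2 fun a ha => h a ha
  rw [pmf_map_apply_eq, h1, ENNReal.toReal_one]

end Queries

/-! ### Agreeing assignments -/

section Agreement
variable {V : Type*} {X : FinComplex V} {k l : ℕ}

theorem Assignment.dist_nonneg (a b : X.Assignment k) : 0 ≤ a.dist b := by
  refine Finset.sum_nonneg fun s _ => ?_
  split_ifs
  · exact X.weight_nonneg _
  · exact le_rfl

theorem LAssignment.dist_nonneg (F H : X.LAssignment k l) : 0 ≤ F.dist H :=
  Finset.sum_nonneg fun s _ => mul_nonneg (X.weight_nonneg _) (by positivity)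

theorem LAssignment.distAgreeing_le (F : X.LAssignment k l) {H : X.LAssignment k l}
    (hH : H.IsAgreeing) : F.distAgreeing ≤ F.dist H :=
  ciInf_le (f := fun H : {H : X.LAssignment k l // H.IsAgreeing} => F.dist H.1)
    ⟨0, by rintro _ ⟨H, rfl⟩; exact F.dist_nonneg H.1⟩ ⟨H, hH⟩

theorem Assignment.exists_dist_eq (a : X.Assignment k) :
    ∃ b : X.Assignment k, b.IsAgreeing ∧ a.dist b = a.distAgreeing := by
  have : Nonempty {b : X.Assignment k // b.IsAgreeing} :=
    ⟨⟨fun _ _ => false, fun _ => false, fun _ _ => rfl⟩⟩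
  obtain ⟨b, hb⟩ := exists_eq_ciInf_of_finite
    (f := fun b : {b : X.Assignment k // b.IsAgreeing} => a.dist b.1)
  exact ⟨b.1, b.2, hb⟩

/-- If after renumbering the lists all `l` assignments are within `D` of agreeing ones, then so is
the `l`-assignment. -/
theorem LAssignment.distAgreeing_le_of_renumbering (F : X.LAssignment k l)
    (g : X.Face k → Equiv.Perm (Fin l)) {D : ℝ} (hD : 0 ≤ D)
    (h : ∀ i, Assignment.distAgreeing (fun s => F s (g s i)) ≤ D) : F.distAgreeing ≤ D := by
  classical
  choose b hb hdist using fun i => Assignment.exists_dist_eq (fun s => F s (g s i))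
  choose f hf using hb
  -- The nearest agreeing assignments `b i` are put back in the original numbering, so that entry `g
  -- s i` of `H` at `s` is `b i s`.
  let H : X.LAssignment k l := fun s i => b ((g s)⁻¹ i) s
  have hH : H.IsAgreeing := by
    refine ⟨f, g, fun i => ?_⟩
    have : (fun s => H s (g s i)) = b i := by
      funext s
      simp [H]
    rw [this]
    exact hf i
  refine (F.distAgreeing_le hH).trans ?_
  have hcard : ∀ s : X.Face k, ((Finset.univ.filter fun i : Fin l => F s i ≠ H s i).card : ℝ) =
      ∑ i : Fin l, if F s (g s i) ≠ b i s then 1 else 0 := by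
    intro s
    rw [Finset.card_filter]
    push_cast
    rw [← Equiv.sum_comp (g s)]
    simp [H]
  -- The normalisation by l makes the distance an average of l distances between ordinary
  -- assignments.
  have hsum : F.dist H = (∑ i : Fin l, Assignment.dist (fun s => F s (g s i)) (b i)) / l := by
    simp only [LAssignment.dist, Assignment.dist]
    rw [Finset.sum_comm, Finset.sum_div]
    refine Finset.sum_congr rfl fun s _ => ?_
    rw [← mul_div_assoc]
    congr 1
    trans X.weight s.1 * ∑ i : Fin l, if F s (g s i) ≠ b i s then (1 : ℝ) else 0
    · rw [← hcard]
    · rw [Finset.mul_sum]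
      refine Finset.sum_congr rfl fun i _ => ?_
      split_ifs <;> simp
  rw [hsum]
  -- For l = 0 the quotient is 0, and the bound is then `hD`.
  refine div_le_of_le_mul₀ (Nat.cast_nonneg _) hD ?_
  calc _ ≤ ∑ _i : Fin l, D := Finset.sum_le_sum fun i _ => (hdist i).trans_le (h i)
    _ = D * l := by simp [mul_comm]

/-! ### Comparing the agreement test with edge weights in the test complex -/

variable [DecidableEq V]

/-- Rejected pairs of positive probability are edges of `X'`, never loops, and their probability is
their weight in `X'`. Sending such a pair to its set of ends embeds them in `U`. -/
theorem AgreementTest.rejectProb_le_norm {T : X.AgreementTest k} {X' : FinComplex (X.Face k)}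
    (hgraph : T.TestGraphIsOneSkeleton X') (a : X.Assignment k) (U : Finset (Finset (X.Face k)))
    (hU : ∀ s t : X.Face k, s ≠ t → {s, t} ∈ X'.faces →
      (∃ (x : V) (hs : x ∈ s.1) (ht : x ∈ t.1), a s ⟨x, hs⟩ ≠ a t ⟨x, ht⟩) → {s, t} ∈ U) :
    T.rejectProb a ≤ X'.norm U := by
  classical
  unfold AgreementTest.rejectProb
  set R : Set (Sym2 (X.Face k)) := {e | ∃ s t : X.Face k, e = s(s, t) ∧
    ∃ (x : V) (hs : x ∈ s.1) (ht : x ∈ t.1), a s ⟨x, hs⟩ ≠ a t ⟨x, ht⟩} with hR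
  let P : Finset (Sym2 (X.Face k)) := Finset.univ.filter fun e => e ∈ R ∧ 0 < T e
  have hP : ∀ e ∈ P, e.toFinset ∈ U ∧ (T e).toReal = X'.weight e.toFinset := by
    intro e he
    obtain ⟨-, ⟨s, t, rfl, hx⟩, hpos⟩ := Finset.mem_filter.1 he
    obtain ⟨hne, hf⟩ := (hgraph.2.1 s t).1 hpos
    rw [Sym2.toFinset_mk_eq]
    exact ⟨hU s t hne hf hx, hgraph.2.2 s t hpos⟩
  have hinj : Set.InjOn (fun e : Sym2 (X.Face k) => e.toFinset) P := by
    intro e _ e' _ h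
    refine Sym2.ext fun x => ?_
    rw [← Sym2.mem_toFinset, ← Sym2.mem_toFinset]
    exact iff_of_eq (congrArg (x ∈ ·) h)
  have hsum : (T.toOuterMeasure R).toReal = ∑ e ∈ P, (T e).toReal := by
    rw [PMF.toOuterMeasure_apply_fintype,
      ENNReal.toReal_sum fun e _ => ne_top_of_le_ne_top (T.apply_ne_top e)
        (Set.indicator_le_self _ _ _), Finset.sum_filter]
    refine Finset.sum_congr rfl fun e _ => ?_
    by_cases h : e ∈ R
    · by_cases h0 : 0 < T e
      · simp [h, h0]
      · simp [h, nonpos_iff_eq_zero.1 (not_lt.1 h0)]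
    · simp [h]
  rw [hsum, Finset.sum_congr rfl fun e he => (hP e he).2,
    ← Finset.sum_image (f := X'.weight) hinj]
  refine Finset.sum_le_sum_of_subset_of_nonneg ?_ fun σ _ _ => X'.weight_nonneg σ
  intro σ hσ
  obtain ⟨e, he, rfl⟩ := Finset.mem_image.1 hσ
  exact (hP e he).1

/-! ### Completeness and soundness of the test for list agreement -/

theorem acceptProb_listAgreementTest_eq_one {T : X.AgreementTest k} {X' : FinComplex (X.Face k)}
    (hdim : 2 ≤ X'.dim) (hgraph : T.TestGraphIsOneSkeleton X') (ρ : X.CoverRule k l)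
    {F : X.LAssignment k l} (hF : F.IsAgreeing) (hsep : T.Separates F) :
    acceptProb (listAgreementTest X' hdim ρ) F = 1 := by
  obtain ⟨f, π, hf⟩ := hF
  have hmatch : ∀ s t : X.Face k, Matches s t (F s) (F t) (π t * (π s)⁻¹) := by
    intro s t x hs ht i
    have h1 := hf ((π s)⁻¹ i) s ⟨x, hs⟩
    have h2 := hf ((π s)⁻¹ i) t ⟨x, ht⟩
    beta_reduce at h1
    rw [show π s ((π s)⁻¹ i) = i by simp] at h1
    exact h1.symm.trans h2
  have hval : ∀ s t : X.Face k, s ≠ t → {s, t} ∈ X'.faces →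
      ρ.value F s t = π s * (π t)⁻¹ := by
    intro s t hne hst
    have hm := ρ.matching s t (F s) (F t) ⟨_, hmatch s t⟩
    -- Two candidate matching permutations take values in the list at `t`, so separation is applied
    -- with `t` as the first face.
    have hed : s(t, s) ∈ T.edges := by
      rw [Sym2.eq_swap]; exact (hgraph.2.1 s t).2 ⟨hne, hst⟩
    have : ρ.perm s t (F s) (F t) = π t * (π s)⁻¹ := by
      ext i
      by_contra hi
      obtain ⟨x, ht, hs, hx⟩ := hsep t s hed _ _ (fun h => hi (congrArg Fin.val h))
      exact hx ((hm x hs ht i).symm.trans (hmatch s t x hs ht i))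
    rw [CoverRule.value, this, mul_inv_rev, inv_inv]
  refine acceptProb_eq_one F fun A hA => ?_
  rcases mem_support_listAgreementTest hA with ⟨p, ⟨hp, τ, hτ, hpτ⟩, rfl⟩ | ⟨p, -, rfl⟩
  · have hedge : ∀ i j : Fin 3, i ≠ j →
        ρ.value F (p i) (p j) = π (p i) * (π (p j))⁻¹ := fun i j hij =>
      hval _ _ (hp.ne hij) (X'.down_closed τ hτ _ (by
        intro x hx
        rcases Finset.mem_insert.1 hx with rfl | hx
        · exact hpτ i
        · exact Finset.mem_singleton.1 hx ▸ hpτ j))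
    rw [run_triangleTest_iff, hedge 0 1 (by decide), hedge 1 2 (by decide), hedge 2 0 (by decide)]
    simp
  · exact (run_edgeTest_iff F p).2 ⟨_, hmatch _ _⟩

/-- Two entries that coincide on s ∩ t can differ only on s \ t, which has k + 1 - |s ∩ t| ≤ r - 1
vertices. -/
theorem LAssignment.LocallyDiffering.separates {T : X.AgreementTest k} {r : ℕ}
    (hr : ∀ s t : X.Face k, s(s, t) ∈ T.edges → k + 2 ≤ (s.1 ∩ t.1).card + r)
    {F : X.LAssignment k l} (hF : F.LocallyDiffering r) : T.Separates F := by
  classical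
  intro s t hst i j hij
  by_contra! h
  have h1 := hF s i j hij
  have h2 := hr s t hst
  have h3 : (Finset.univ.filter (fun x => F s i x ≠ F s j x)).card ≤ (s.1 \ t.1).card := by
    rw [← Finset.card_map (Function.Embedding.subtype _)]
    refine Finset.card_le_card fun x hx => ?_
    obtain ⟨y, hy, rfl⟩ := Finset.mem_map.1 hx
    exact Finset.mem_sdiff.2 ⟨y.2, fun ht => (Finset.mem_filter.1 hy).2 (h y.1 y.2 ht)⟩
  have h4 := Finset.card_sdiff_add_card_inter s.1 t.1
  have h5 : s.1.card = k + 1 := (Finset.mem_filter.1 s.2).2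
  have h6 : (Finset.univ.filter (fun x => F s i x ≠ F s j x)).card ≥ r := by
    convert h1
  omega

/-- Whether an antisymmetric group-valued function is a cocycle on a triangle does not depend on
the ordering of the vertices. -/
theorem triangle_product_ne_one {S G : Type*} [Group G] {c : S → S → G}
    (hc : ∀ x y, x ≠ y → c y x = (c x y)⁻¹) {p : Fin 3 → S} (hp : Function.Injective p)
    {x y z : S} (hxy : x ≠ y) (hyz : y ≠ z) (hzx : z ≠ x)
    (hx : ∃ i, p i = x) (hy : ∃ i, p i = y) (hz : ∃ i, p i = z)
    (h : c x y * c y z * c z x ≠ 1) : c (p 0) (p 1) * c (p 1) (p 2) * c (p 2) (p 0) ≠ 1 := by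
  have h01 := hc (p 0) (p 1) (hp.ne (by decide))
  have h12 := hc (p 1) (p 2) (hp.ne (by decide))
  have h20 := hc (p 2) (p 0) (hp.ne (by decide))
  have rot : ∀ a b d : G, a * b * d = 1 → b * d * a = 1 := fun a b d h => by
    rw [mul_assoc] at h
    exact mul_eq_one_comm.1 h
  contrapose! h
  -- Cyclic rotations account for the three even orderings. An odd ordering gives the inverse of one
  -- of these products, by antisymmetry of `c`.
  have e1 := rot _ _ _ h
  have e2 := rot _ _ _ e1
  obtain ⟨i, rfl⟩ := hx
  obtain ⟨j, rfl⟩ := hy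
  obtain ⟨m, rfl⟩ := hz
  have inv : ∀ {a b d : G}, a * b * d = 1 → d⁻¹ * b⁻¹ * a⁻¹ = 1 := fun {a b d} h => by
    rw [← inv_eq_one, ← h]; group
  fin_cases i <;> fin_cases j <;> fin_cases m <;>
    first
    | exact absurd rfl hxy
    | exact absurd rfl hyz
    | exact absurd rfl hzx
    | exact h
    | exact e1
    | exact e2
    | (simp only [Fin.zero_eta, Fin.mk_one, Fin.reduceFinMk, h01, h12, h20]
       first
       | exact inv h
       | exact inv e1
       | exact inv e2)

theorem mul_distAgreeing_le_rejectProb {T : X.AgreementTest k} {α : ℝ} (hα : 0 < α)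
    (hT : T.HasSoundness α) {X' : FinComplex (X.Face k)} (hdim : 2 ≤ X'.dim) {γ : ℝ} (hγ : 0 < γ)
    (hexp : X'.IsCoboundaryExpander (Equiv.Perm (Fin l)) γ) (hgraph : T.TestGraphIsOneSkeleton X')
    (ρ : X.CoverRule k l) (F : X.LAssignment k l) :
    α * γ / (2 * (γ + 1)) * F.distAgreeing ≤ rejectProb (listAgreementTest X' hdim ρ) F := by
  classical
  have h3 : 3 ≤ X'.rank := by unfold dim at hdim; omega
  have h2 : 2 ≤ X'.rank := by omega
  let c : X'.Cochain1 (Equiv.Perm (Fin l)) :=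
    ⟨fun e => ρ.value F e.1.1 e.1.2, fun e => ρ.value_symm F e.2.1⟩
  obtain ⟨g, hg⟩ := hexp.exists_norm1_le hdim c
  set N := norm1 (fun e => c.1 e * ((d0 g).1 e)⁻¹) with hN
  let S : Finset (Finset (X.Face k)) := (X'.facesOfDim 1).filter fun σ =>
    ∃ s t, s ≠ t ∧ σ = {s, t} ∧ ¬ ∃ π, Matches s t (F s) (F t) π
  have htri : norm2 (d1 c) ≤
      ((X'.sampleFace 3 h3).toOuterMeasure {p | (triangleTest ρ p).run F = false}).toReal := by
    obtain ⟨B, hB, hmem⟩ := exists_norm2_eq (d1 c)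
    rw [hB]
    refine X'.norm_le_sampleFace h3 _ (fun σ hσ =>
      (Finset.mem_filter.1 ((hmem σ).1 hσ).1).2) _ ?_
    intro p hp σ hσ hpσ
    obtain ⟨-, t, rfl, ht⟩ := (hmem σ).1 hσ
    refine Bool.eq_false_iff.2 (mt (run_triangleTest_iff F ρ p).1 <|
      triangle_product_ne_one (c := ρ.value F) (fun s t h => ρ.value_symm F h) hp
        t.2.1.1 t.2.1.2.1 t.2.1.2.2 ?_ ?_ ?_ ht) <;>
    exact (hpσ _).1 (by simp)
  have hedge : X'.norm S ≤
      ((X'.sampleFace 2 h2).toOuterMeasure {p | (edgeTest p).run F = false}).toReal := by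
    refine X'.norm_le_sampleFace h2 _ (fun σ hσ =>
      (Finset.mem_filter.1 (Finset.mem_filter.1 hσ).1).2) _ ?_
    intro p hp σ hσ hpσ
    obtain ⟨-, s, t, hst, rfl, hm⟩ := Finset.mem_filter.1 hσ
    refine Bool.eq_false_iff.2 (mt (run_edgeTest_iff F p).1 ?_)
    obtain ⟨i, rfl⟩ := (hpσ s).1 (by simp)
    obtain ⟨j, rfl⟩ := (hpσ t).1 (by simp)
    fin_cases i <;> fin_cases j
    · exact absurd rfl hst
    · exact hm
    · exact fun h => hm (matches_inv_iff.1 h)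
    · exact absurd rfl hst
  -- Every k-face is a vertex of `X'`, so the 0-cochain renumbers all the lists.
  let g' : X.Face k → Equiv.Perm (Fin l) := fun s => g ⟨s, hgraph.1 s⟩
  have hreject : ∀ i, T.rejectProb (fun s => F s (g' s i)) ≤ N + X'.norm S := by
    intro i
    obtain ⟨B, hB, hmem⟩ := exists_norm1_eq fun e => c.1 e * ((d0 g).1 e)⁻¹
    rw [hN, hB]
    refine le_trans (AgreementTest.rejectProb_le_norm hgraph _ (B ∪ S) ?_) (X'.norm_union_le B S)
    intro s t hne hst ⟨x, hs, ht, hx⟩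
    have hdim1 : {s, t} ∈ X'.facesOfDim 1 :=
      Finset.mem_filter.2 ⟨hst, Finset.card_pair hne⟩
    by_cases hm : ∃ π, Matches s t (F s) (F t) π
    · refine Finset.mem_union_left _ ((hmem _).2 ⟨hdim1, ⟨(s, t), hne, hst⟩, rfl, ?_⟩)
      -- If c = d₀g on this edge, the matching permutation is g(t)g(s)⁻¹. It sends index g(s)i to
      -- g(t)i, which contradicts the disagreement at `x`.
      intro hc
      have hc' : (ρ.perm s t (F s) (F t))⁻¹ = g' s * (g' t)⁻¹ := mul_inv_eq_one.1 hc
      refine hx ((ρ.matching s t _ _ hm x hs ht _).trans ?_)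
      rw [inv_eq_iff_eq_inv.1 hc']
      simp
    · exact Finset.mem_union_right _ (Finset.mem_filter.2 ⟨hdim1, s, t, hne, rfl, hm⟩)
  have hS0 := X'.norm_nonneg S
  have hN0 : 0 ≤ N := X'.norm_nonneg _
  have hdist : F.distAgreeing ≤ (N + X'.norm S) / α := by
    refine F.distAgreeing_le_of_renumbering g' (by positivity) fun i => ?_
    rw [le_div_iff₀ hα, mul_comm]
    exact (hT _).trans (hreject i)
  rw [rejectProb_listAgreementTest F X' hdim h3 h2 ρ]
  calc α * γ / (2 * (γ + 1)) * F.distAgreeing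
      ≤ α * γ / (2 * (γ + 1)) * ((N + X'.norm S) / α) := by gcongr
    _ = (γ * N + γ * X'.norm S) / (γ + 1) / 2 := by field_simp
    _ ≤ (norm2 (d1 c) + X'.norm S) / 2 := by
      gcongr
      rw [div_le_iff₀ (by positivity)]
      have : 0 ≤ norm2 (d1 c) := X'.norm_nonneg _
      -- With D = ‖d₁c‖, the inequality γN ≤ D gives γN + γ‖S‖ ≤ D + γ‖S‖ ≤ (γ + 1)(D + ‖S‖). This
      -- is where the factor γ + 1 comes from.
      nlinarith
    _ ≤ _ := by gcongr

end Agreement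

end FinComplex

theorem mainTheorem9 {V : Type*} [DecidableEq V] (X : FinComplex V) (hX : X.IsPure) (k l : ℕ)
    -- an agreement test on the `k`-faces of `X`, with soundness `α`
    (T : X.AgreementTest k) (α : ℝ) (hα : 0 < α) (hT : T.HasSoundness α)
    -- a coboundary expander whose weighted `1`-skeleton is the test graph
    (X' : FinComplex (X.Face k)) (hX' : X'.IsPure) (hdim : 2 ≤ X'.dim)
    (γ : ℝ) (hγ : 0 < γ) (hexp : X'.IsCoboundaryExpander (Equiv.Perm (Fin l)) γ)
    (hgraph : T.TestGraphIsOneSkeleton X')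
    -- any way to choose the matching permutations
    (ρ : X.CoverRule k l) :
    -- query complexity
    (∀ A ∈ (FinComplex.listAgreementTest X' hdim ρ).support, ∀ F : X.LAssignment k l,
      A.queries F ≤ 3 * l) ∧
    -- soundness
    (∀ F : X.LAssignment k l, α * γ / (2 * (γ + 1)) * F.distAgreeing ≤
      FinComplex.rejectProb (FinComplex.listAgreementTest X' hdim ρ) F) ∧
    -- completeness
    (∀ F : X.LAssignment k l, F.IsAgreeing → T.Separates F →
      FinComplex.acceptProb (FinComplex.listAgreementTest X' hdim ρ) F = 1) ∧
    -- completeness for locally differing lists (`r = 2` if the faces of each tested pair share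
    -- all but one of their vertices)
    (∀ r : ℕ, (∀ s t : X.Face k, s(s, t) ∈ T.edges → k + 2 ≤ (s.1 ∩ t.1).card + r) →
      ∀ F : X.LAssignment k l, F.IsAgreeing → F.LocallyDiffering r →
        FinComplex.acceptProb (FinComplex.listAgreementTest X' hdim ρ) F = 1) := by
  exact ⟨fun _ hA F => FinComplex.queries_listAgreementTest_le F hA,
    FinComplex.mul_distAgreeing_le_rejectProb hα hT hdim hγ hexp hgraph ρ,
    fun _ hF hsep => FinComplex.acceptProb_listAgreementTest_eq_one hdim hgraph ρ hF hsep,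
    fun _ hr _ hF hd => FinComplex.acceptProb_listAgreementTest_eq_one hdim hgraph ρ hF
      (hd.separates hr)⟩
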